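/- Let $G$ be a finite simple graph with vertex set $V$, let $k$ be a field of any characteristic, let $R=k[x_v,y_v : v\in V]$, and let $\mathcal J(G)=(x_iy_j-x_jy_i : \{i,j\}\in E(G))\subseteq R$ be the binomial edge ideal of $G$. A linear forest in $G$ is a spanning subgraph $F$ of $G$ (so $V(F)=V$) every connected component of which is a path, where a single vertex counts as a path; it is maximal if no linear forest in $G$ has more edges, and $\mathsf{LF}(G)$ denotes the number of edges of a maximal linear forest in $G$. A leaf of $F$ is a vertex of degree at most $1$ in $F$ (an end point of one of its paths, including isolated vertices). The ideal $\mathcal J(G)$ is of König type if $\operatorname{grade}_R(\mathcal J(G))=\mathsf{LF}(G)$, where $\operatorname{grade}_R(I)$ is the supremum of the lengths of $R$-regular sequences contained in $I$. For a maximal linear forest $F$ in $G$ and $S\subseteq V$, the pair $(F,S)$ is an $\mathsf{LF}$-cover of $G$ if (1) no vertex in $S$ is a leaf of $F$; (2) no two vertices in $S$ are adjacent in $F$; and (3) for every edge $\{i,j\}\in E(G)$, either at least one of $i,j$ belongs to $S$, or $i$ and $j$ belong to the same connected component of $F\setminus S$. The graph $G$ is $\mathsf{LF}$-coverable if it has an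 $\mathsf{LF}$-cover $(F,S)$ for some maximal linear forest $F$ in $G$ and some $S\subseteq V$. Theorem. $\mathcal J(G)$ is of König type if and only if $G$ is $\mathsf{LF}$-coverable. Furthermore, for any two maximal linear forests $F$ and $F'$ in $G$ and any $S\subseteq V$, $(F,S)$ is an $\mathsf{LF}$-cover of $G$ if and only if $(F',S)$ is an $\mathsf{LF}$-cover of $G$. -/

import Mathlib

/-- A graph is a linear forest if every connected component is a path (possibly a single vertex). -/
def IsLinearForest {V : Type*} (F : SimpleGraph V) : Prop :=
  ∀ c : F.ConnectedComponent, ∃ m : ℕ, Nonempty (c.toSimpleGraph ≃g SimpleGraph.pathGraph m)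

/-- `F` is a maximal linear forest in `G`: a linear forest contained in `G` such that no linear
forest in `G` has more edges. Linear forests in `G` are spanning subgraphs: a vertex of `G` that
lies on no edge of `F` is a one-vertex path of `F`. -/
structure IsMaximalLinearForest {V : Type*} (G F : SimpleGraph V) : Prop where
  le : F ≤ G
  isLinearForest : IsLinearForest F
  maximal : ∀ F' : SimpleGraph V, F' ≤ G → IsLinearForest F' →
    F'.edgeSet.encard ≤ F.edgeSet.encard

/-- `LF(G)`, the largest number of edges of a linear forest in `G`. -/
noncomputable def LF {V : Type*} (G : SimpleGraph V) : ℕ∞ :=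
  ⨆ (F : SimpleGraph V) (_ : F ≤ G) (_ : IsLinearForest F), F.edgeSet.encard

/-- A leaf of a linear forest is an end point of one of its paths, that is, a vertex of degree at
most one; the only vertex of a one-vertex path is a leaf. -/
def IsLeaf {V : Type*} (F : SimpleGraph V) (v : V) : Prop :=
  (F.neighborSet v).encard ≤ 1

/-- `(F, S)` is an `LF`-cover of `G`. -/
structure IsLFCover {V : Type*} (G F : SimpleGraph V) (S : Set V) : Prop where
  isMaximal : IsMaximalLinearForest G F
  not_leaf : ∀ v ∈ S, ¬ IsLeaf F v
  not_adj : ∀ v ∈ S, ∀ w ∈ S, ¬ F.Adj v w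
  covers : ∀ i j : V, G.Adj i j → (i ∈ S ∨ j ∈ S) ∨
    ∃ (hi : i ∈ Sᶜ) (hj : j ∈ Sᶜ), (F.induce Sᶜ).Reachable ⟨i, hi⟩ ⟨j, hj⟩

/-- `G` is `LF`-coverable. -/
def IsLFCoverable {V : Type*} (G : SimpleGraph V) : Prop :=
  ∃ (F : SimpleGraph V) (S : Set V), IsLFCover G F S

/-- The binomial `x_i y_j - x_j y_i` in the polynomial ring with variables `x_v = X (inl v)` and
`y_v = X (inr v)`, for `v` in `V`. -/
noncomputable def edgeBinomial (k : Type*) [Field k] {V : Type*} (i j : V) :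
    MvPolynomial (V ⊕ V) k :=
  MvPolynomial.X (Sum.inl i) * MvPolynomial.X (Sum.inr j) -
    MvPolynomial.X (Sum.inl j) * MvPolynomial.X (Sum.inr i)

/-- The binomial edge ideal of `G`. An edge is listed in both orders, which only adds the negatives
of generators. -/
noncomputable def binomialEdgeIdeal (k : Type*) [Field k] {V : Type*} (G : SimpleGraph V) :
    Ideal (MvPolynomial (V ⊕ V) k) :=
  Ideal.span {f | ∃ i j : V, G.Adj i j ∧ f = edgeBinomial k i j}

/-- The grade of an ideal `I` of `R`: the supremum of the lengths of the `R`-regular sequences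
consisting of elements of `I`. -/
noncomputable def idealGrade {R : Type*} [CommRing R] (I : Ideal R) : ℕ∞ :=
  ⨆ (rs : List R) (_ : RingTheory.Sequence.IsRegular R rs) (_ : ∀ r ∈ rs, r ∈ I),
    (rs.length : ℕ∞)

/-- The binomial edge ideal of `G` over `k` is of König type. -/
def IsKonigType (k : Type*) [Field k] {V : Type*} (G : SimpleGraph V) : Prop :=
  idealGrade (binomialEdgeIdeal k G) = LF G

/-! Write c(G \ S) for the number of components of G \ S. Both sides of the equivalence are compared
with the numbers |V| + |S| - c(G \ S), S ⊆ V.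

Algebra: grade J(G) is the minimum of these numbers (`exists_idealGrade_add_card`). For each S the
cut ideal, generated by the variables of S and all 2-minors inside each component of G \ S, contains
J(G). It also contains an explicit regular sequence of length |V| + |S| - c(G \ S), modulo which it
kills a nonzero element, so by Rees' theorem (`AnnihilatesMod.length_le`) no regular sequence in
J(G) is longer. Conversely, a longest regular sequence in J(G) has an associated prime Q containing
J(G). Such a Q contains the cut ideal for the set S of vertices whose two variables lie in Q, and
Rees' theorem modulo that sequence gives equality for this S. Nothing depends on the characteristic.

Combinatorics: for a linear forest F in G, deleting S removes at most 2|S| edges, F \ S is acyclic,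
and c(G \ S) ≤ c(F \ S). Hence |E(F)| ≤ |V| + |S| - c(G \ S). Equality forces S to be independent in
F with all degrees two, and c(F \ S) = c(G \ S). For maximal F these are exactly the conditions of
an LF-cover (`IsMaximalLinearForest.isLFCover_iff`).

So the König property says that LF(G) equals the minimum, i.e. that some S gives equality. As
equality sees F only through its number of edges, the choice of maximal F is irrelevant. -/

/-- `r` is a nonzerodivisor modulo the ideal `I`. -/
def RegularMod {R : Type*} [CommRing R] (I : Ideal R) (r : R) : Prop :=
  ∀ g : R, r * g ∈ I → g ∈ I

/-- `rs` is a weakly regular sequence on `R ⧸ I`. -/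
def RegularSeqMod {R : Type*} [CommRing R] : Ideal R → List R → Prop
  | _, [] => True
  | I, r :: rs => RegularMod I r ∧ RegularSeqMod (I ⊔ Ideal.span {r}) rs

/-- `r` is a nonzerodivisor modulo `I` and modulo `I` plus any initial segment of `rs`. -/
def RegularModPrefixes {R : Type*} [CommRing R] (r : R) : Ideal R → List R → Prop
  | I, [] => RegularMod I r
  | I, x :: xs => RegularMod I r ∧ RegularModPrefixes r (I ⊔ Ideal.span {x}) xs

/-- The ideal `P` consists of zerodivisors on `R ⧸ I`, witnessed by a single nonzero element. -/
def AnnihilatesMod {R : Type*} [CommRing R] (P I : Ideal R) : Prop :=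
  ∃ m : R, m ∉ I ∧ ∀ p ∈ P, p * m ∈ I

/-! ### Rees' theorem: exchanging elements of regular sequences -/

section Rees

variable {R : Type*} [CommRing R]

theorem AnnihilatesMod.not_regularMod {P I : Ideal R} (h : AnnihilatesMod P I) {p : R}
    (hp : p ∈ P) : ¬ RegularMod I p := by
  obtain ⟨m, hm, hP⟩ := h
  exact fun hr => hm (hr m (hP p hp))

theorem regularSeqMod_append {I : Ideal R} {as bs : List R} :
    RegularSeqMod I (as ++ bs) ↔
      RegularSeqMod I as ∧ RegularSeqMod (I ⊔ Ideal.ofList as) bs := by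
  induction as generalizing I with
  | nil => simp [RegularSeqMod]
  | cons a as ih =>
    simp only [List.cons_append, RegularSeqMod, ih, Ideal.ofList_cons, sup_assoc, and_assoc]

theorem regularSeqMod_iff_getElem {I : Ideal R} {rs : List R} :
    RegularSeqMod I rs ↔
      ∀ i (h : i < rs.length), RegularMod (I ⊔ Ideal.ofList (rs.take i)) rs[i] := by
  induction rs generalizing I with
  | nil => simp [RegularSeqMod]
  | cons r rs ih =>
    simp only [RegularSeqMod, ih]
    constructor
    · rintro ⟨h0, h⟩ (_ | i) hi
      · simpa using h0
      · simpa [sup_assoc] using h i (by simpa using hi)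
    · intro h
      have h0 := h 0 (by simp)
      rw [List.take_zero, Ideal.ofList_nil, sup_bot_eq] at h0
      refine ⟨h0, fun i hi => ?_⟩
      have hi' := h (i + 1) (by simpa using hi)
      rw [List.take_succ_cons, Ideal.ofList_cons, ← sup_assoc] at hi'
      exact hi'

theorem isSMulRegular_quotient_iff_regularMod {I : Ideal R} {r : R} :
    IsSMulRegular (R ⧸ I) r ↔ RegularMod I r := by
  rw [isSMulRegular_iff_right_eq_zero_of_smul]
  constructor
  · intro h g hg
    have := h (Ideal.Quotient.mk I g) (by
      rw [Algebra.smul_def, Ideal.Quotient.algebraMap_eq, ← map_mul]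
      exact Ideal.Quotient.eq_zero_iff_mem.2 hg)
    exact Ideal.Quotient.eq_zero_iff_mem.1 this
  · intro h x hx
    obtain ⟨g, rfl⟩ := Ideal.Quotient.mk_surjective x
    rw [Algebra.smul_def, Ideal.Quotient.algebraMap_eq, ← map_mul,
      Ideal.Quotient.eq_zero_iff_mem] at hx
    exact Ideal.Quotient.eq_zero_iff_mem.2 (h g hx)

theorem isWeaklyRegular_iff_regularSeqMod {rs : List R} :
    RingTheory.Sequence.IsWeaklyRegular R rs ↔ RegularSeqMod ⊥ rs := by
  rw [RingTheory.Sequence.isWeaklyRegular_iff, regularSeqMod_iff_getElem]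
  refine forall₂_congr fun i hi => ?_
  rw [← isSMulRegular_quotient_iff_regularMod, bot_sup_eq]
  have e : (Ideal.ofList (rs.take i) • ⊤ : Submodule R R) = Ideal.ofList (rs.take i) := by
    rw [smul_eq_mul, Ideal.mul_top]
  rw [e]

theorem isRegular_iff_regularSeqMod {rs : List R} :
    RingTheory.Sequence.IsRegular R rs ↔ RegularSeqMod ⊥ rs ∧ Ideal.ofList rs ≠ ⊤ := by
  rw [RingTheory.Sequence.isRegular_iff, isWeaklyRegular_iff_regularSeqMod, smul_eq_mul,
    Ideal.mul_top, ne_comm]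

/-- This half of permuting a regular pair holds without any local or graded hypothesis; regularity
of `z` modulo `I` itself is not recovered, which is why prefixes are tracked below. -/
theorem RegularMod.swap {I : Ideal R} {x z : R} (hx : RegularMod I x)
    (hz : RegularMod (I ⊔ Ideal.span {x}) z) : RegularMod (I ⊔ Ideal.span {z}) x := by
  intro g hg
  obtain ⟨i, hi, t, ht, e⟩ := Submodule.mem_sup.1 hg
  obtain ⟨h, rfl⟩ := Ideal.mem_span_singleton'.1 ht
  have h1 : z * h ∈ I ⊔ Ideal.span {x} :=
    Submodule.mem_sup.2 ⟨-i, I.neg_mem hi, x * g,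
      Ideal.mem_span_singleton'.2 ⟨g, mul_comm _ _⟩, by rw [← e]; ring⟩
  obtain ⟨i', hi', t', ht', e'⟩ := Submodule.mem_sup.1 (hz h h1)
  obtain ⟨h', rfl⟩ := Ideal.mem_span_singleton'.1 ht'
  have h2 : x * (g - z * h') ∈ I := by
    have : x * (g - z * h') = i + z * i' := by
      rw [mul_sub, ← e, ← e']; ring
    rw [this]
    exact I.add_mem hi (I.mul_mem_left _ hi')
  exact Submodule.mem_sup.2 ⟨_, hx _ h2, z * h',
    Ideal.mem_span_singleton'.2 ⟨h', mul_comm _ _⟩, by ring⟩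

theorem RegularModPrefixes.regularMod {I : Ideal R} {xs : List R} {z : R}
    (h : RegularModPrefixes z I xs) : RegularMod I z := by
  cases xs with
  | nil => exact h
  | cons => exact h.1

theorem RegularModPrefixes.regularMod_ofList {I : Ideal R} {xs : List R} {z : R}
    (h : RegularModPrefixes z I xs) : RegularMod (I ⊔ Ideal.ofList xs) z := by
  induction xs generalizing I with
  | nil => simpa [RegularModPrefixes] using h
  | cons x xs ih => simpa [sup_assoc] using ih h.2

/-- Moves `z` from the end of the sequence to its front by repeated use of `RegularMod.swap`. -/
theorem RegularSeqMod.sup_span {I : Ideal R} {xs : List R} {z : R} (hxs : RegularSeqMod I xs)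
    (hz : RegularModPrefixes z I xs) : RegularSeqMod (I ⊔ Ideal.span {z}) xs := by
  induction xs generalizing I with
  | nil => trivial
  | cons x xs ih =>
    refine ⟨hxs.1.swap hz.2.regularMod, ?_⟩
    rw [sup_right_comm]
    exact ih hxs.2 hz.2

/-- If `m` is killed by `P` modulo `J + (x)`, then `z * m ≡ m' * x` modulo `J`, and `m'` is the
witness modulo `J + (z)`. The relation is symmetric in the pairs `(x, m)` and `(z, m')`, so
regularity of `z` keeps `m'` nonzero and regularity of `x` makes `P` kill it. -/
theorem AnnihilatesMod.exchange {P J : Ideal R} {x z : R} (hx : RegularMod J x)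
    (hz : RegularMod J z) (hzP : z ∈ P)
    (h : AnnihilatesMod P (J ⊔ Ideal.span {x})) : AnnihilatesMod P (J ⊔ Ideal.span {z}) := by
  obtain ⟨m, hm, hP⟩ := h
  obtain ⟨j, hj, t, ht, e⟩ := Submodule.mem_sup.1 (hP z hzP)
  obtain ⟨m', rfl⟩ := Ideal.mem_span_singleton'.1 ht
  refine ⟨m', fun hm' => hm ?_, fun p hp => ?_⟩
  · obtain ⟨j', hj', t', ht', e'⟩ := Submodule.mem_sup.1 hm'
    obtain ⟨a, rfl⟩ := Ideal.mem_span_singleton'.1 ht'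
    have : z * (m - a * x) ∈ J := by
      have : z * (m - a * x) = j + j' * x := by rw [mul_sub, ← e, ← e']; ring
      rw [this]
      exact J.add_mem hj (J.mul_mem_right _ hj')
    exact Submodule.mem_sup.2 ⟨_, hz _ this, a * x, Ideal.mem_span_singleton'.2 ⟨a, rfl⟩, by ring⟩
  · obtain ⟨j', hj', t', ht', e'⟩ := Submodule.mem_sup.1 (hP p hp)
    obtain ⟨b, rfl⟩ := Ideal.mem_span_singleton'.1 ht'
    have : x * (p * m' - b * z) ∈ J := by
      have : x * (p * m' - b * z) = z * j' - p * j := by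
        have e1 : m' * x = z * m - j := by rw [← e]; ring
        have e2 : b * x = p * m - j' := by rw [← e']; ring
        linear_combination p * e1 - z * e2
      rw [this]
      exact J.sub_mem (J.mul_mem_left _ hj') (J.mul_mem_left _ hj)
    exact Submodule.mem_sup.2 ⟨_, hx _ this, b * z, Ideal.mem_span_singleton'.2 ⟨b, rfl⟩, by ring⟩

theorem IsAssociatedPrime.annihilatesMod [IsNoetherianRing R] {Q J : Ideal R}
    (hQ : IsAssociatedPrime Q (R ⧸ J)) : AnnihilatesMod Q J := by
  obtain ⟨-, x, hx⟩ := isAssociatedPrime_iff.1 hQ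
  obtain ⟨m, rfl⟩ := Ideal.Quotient.mk_surjective x
  have key : ∀ q : R, q ∈ Q ↔ q * m ∈ J := fun q => by
    rw [hx, Submodule.mem_colon_singleton, Submodule.mem_bot, Algebra.smul_def,
      Ideal.Quotient.algebraMap_eq, ← map_mul, Ideal.Quotient.eq_zero_iff_mem]
  refine ⟨m, fun hm => hQ.isPrime.ne_top ?_, fun q hq => (key q).1 hq⟩
  rw [Ideal.eq_top_iff_one, key, one_mul]
  exact hm

/-- Prime avoidance, applied to the finitely many associated primes of all the quotients together.
-/
theorem exists_le_associated_of_forall_not_regularMod [IsNoetherianRing R] {ι : Type*}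
    (s : Finset ι) (J : ι → Ideal R) {P : Ideal R}
    (h : ∀ p ∈ P, ∃ i ∈ s, ¬ RegularMod (J i) p) :
    ∃ i ∈ s, ∃ Q : Ideal R, Q.IsPrime ∧ P ≤ Q ∧ AnnihilatesMod Q (J i) := by
  classical
  have hfin : (⋃ i ∈ s, associatedPrimes R (R ⧸ J i)).Finite :=
    s.finite_toSet.biUnion fun i _ => associatedPrimes.finite R (R ⧸ J i)
  have hsub : (P : Set R) ⊆ ⋃ Q ∈ (⋃ i ∈ s, associatedPrimes R (R ⧸ J i)), (Q : Set R) := by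
    intro p hp
    obtain ⟨i, hi, hreg⟩ := h p hp
    have : p ∈ ⋃ Q ∈ associatedPrimes R (R ⧸ J i), (Q : Set R) := by
      rw [biUnion_associatedPrimes_eq_zero_divisors]
      simp only [RegularMod, not_forall] at hreg
      obtain ⟨g, hg, hgJ⟩ := hreg
      refine ⟨Ideal.Quotient.mk _ g, fun h0 => hgJ (Ideal.Quotient.eq_zero_iff_mem.1 h0), ?_⟩
      rw [Algebra.smul_def, Ideal.Quotient.algebraMap_eq, ← map_mul]
      exact Ideal.Quotient.eq_zero_iff_mem.2 hg
    simp only [Set.mem_iUnion] at this ⊢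
    obtain ⟨Q, hQ, hpQ⟩ := this
    exact ⟨Q, ⟨i, hi, hQ⟩, hpQ⟩
  obtain ⟨Q, hQ, hPQ⟩ := (P.subset_union_prime_finite hfin (f := id) 0 0 fun Q hQ _ _ => by
    simp only [Set.mem_iUnion] at hQ
    obtain ⟨i, _, hQ⟩ := hQ
    exact hQ.isPrime).1 hsub
  simp only [Set.mem_iUnion] at hQ
  obtain ⟨i, hi, hQ⟩ := hQ
  refine ⟨i, hi, Q, hQ.isPrime, hPQ, hQ.annihilatesMod⟩

theorem regularModPrefixes_iff {I : Ideal R} {xs : List R} {z : R} :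
    RegularModPrefixes z I xs ↔
      ∀ i ∈ Finset.range (xs.length + 1), RegularMod (I ⊔ Ideal.ofList (xs.take i)) z := by
  induction xs generalizing I with
  | nil => simp [RegularModPrefixes]
  | cons x xs ih =>
    simp only [RegularModPrefixes, ih, Finset.mem_range]
    constructor
    · rintro ⟨h0, h⟩ (_ | i) hi
      · simpa using h0
      · simpa [sup_assoc] using h i (by simpa using hi)
    · intro h
      refine ⟨by simpa using h 0 (by simp), fun i hi => ?_⟩
      simpa [sup_assoc] using h (i + 1) (by simpa using hi)

/-- Supplies one element of `P` to exchange for the last terms of both sequences. Modulo each proper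
prefix the next term is a regular element of `P`, so `P` lies in none of the associated primes
involved and prime avoidance applies. -/
theorem exists_regularModPrefixes [IsNoetherianRing R] {P I : Ideal R} {xs ys : List R} {x y : R}
    (hxs : RegularSeqMod I (xs ++ [x])) (hxP : ∀ r ∈ xs ++ [x], r ∈ P)
    (hys : RegularSeqMod I (ys ++ [y])) (hyP : ∀ r ∈ ys ++ [y], r ∈ P) :
    ∃ z ∈ P, RegularModPrefixes z I xs ∧ RegularModPrefixes z I ys := by
  by_contra! hcon
  let s : Finset (ℕ ⊕ ℕ) :=
    (Finset.range (xs.length + 1)).disjSum (Finset.range (ys.length + 1))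
  let J : ℕ ⊕ ℕ → Ideal R :=
    Sum.elim (fun i => I ⊔ Ideal.ofList (xs.take i)) (fun i => I ⊔ Ideal.ofList (ys.take i))
  have aux : ∀ (ls : List R) (l : R), RegularSeqMod I (ls ++ [l]) → (∀ r ∈ ls ++ [l], r ∈ P) →
      ∀ i < ls.length + 1, ∃ p ∈ P, RegularMod (I ⊔ Ideal.ofList (ls.take i)) p := by
    intro ls l hreg hP i hi
    have h := regularSeqMod_iff_getElem.1 hreg i (by simpa using hi)
    rw [List.take_append_of_le_length (by omega)] at h
    exact ⟨_, hP _ (List.getElem_mem _), h⟩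
  obtain ⟨i, hi, Q, -, hPQ, hQ⟩ := exists_le_associated_of_forall_not_regularMod s J (P := P) (by
    intro p hp
    by_contra! h
    refine hcon p hp (regularModPrefixes_iff.2 fun i hi => ?_)
      (regularModPrefixes_iff.2 fun i hi => ?_)
    · exact h (Sum.inl i) (by simpa [s] using hi)
    · exact h (Sum.inr i) (by simpa [s] using hi))
  rcases i with i | i
  · obtain ⟨p, hp, h⟩ := aux xs x hxs hxP i (by simpa [s] using hi)
    exact hQ.not_regularMod (hPQ hp) h
  · obtain ⟨p, hp, h⟩ := aux ys y hys hyP i (by simpa [s] using hi)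
    exact hQ.not_regularMod (hPQ hp) h

/-- Replace the last term of each sequence by a common `z`, move `z` to the front, and induct on the
shortened sequences modulo `I + (z)`. -/
theorem AnnihilatesMod.of_length_eq [IsNoetherianRing R] {P I : Ideal R} {xs ys : List R}
    (hxs : RegularSeqMod I xs) (hxP : ∀ r ∈ xs, r ∈ P)
    (hys : RegularSeqMod I ys) (hyP : ∀ r ∈ ys, r ∈ P) (hlen : xs.length = ys.length)
    (h : AnnihilatesMod P (I ⊔ Ideal.ofList xs)) :
    AnnihilatesMod P (I ⊔ Ideal.ofList ys) := by
  induction hn : xs.length generalizing I xs ys with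
  | zero =>
    rw [List.length_eq_zero_iff.1 hn] at h
    rwa [List.length_eq_zero_iff.1 (hlen.symm.trans hn)]
  | succ n ih =>
    obtain ⟨xs, x, rfl⟩ := (List.eq_nil_or_concat' xs).resolve_left
      (List.ne_nil_of_length_eq_add_one hn)
    obtain ⟨ys, y, rfl⟩ := (List.eq_nil_or_concat' ys).resolve_left
      (List.ne_nil_of_length_eq_add_one (hlen.symm.trans hn))
    obtain ⟨z, hz, hzx, hzy⟩ := exists_regularModPrefixes hxs hxP hys hyP
    rw [regularSeqMod_append] at hxs hys
    rw [Ideal.ofList_append, Ideal.ofList_singleton, ← sup_assoc] at h ⊢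
    have h1 : AnnihilatesMod P (I ⊔ Ideal.span {z} ⊔ Ideal.ofList xs) := by
      rw [sup_right_comm]
      exact h.exchange hxs.2.1 hzx.regularMod_ofList hz
    have h2 := ih (hxs.1.sup_span hzx) (fun r hr => hxP r (by simp [hr])) (hys.1.sup_span hzy)
      (fun r hr => hyP r (by simp [hr])) (by simpa using hlen) h1 (by simpa using hn)
    rw [sup_right_comm] at h2
    exact h2.exchange hzy.regularMod_ofList hys.2.1 (hyP y (by simp))

/-- If `P` annihilates a nonzero element modulo a weakly regular sequence `xs` contained in `P`,
then no weakly regular sequence contained in `P` is longer than `xs`. -/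
theorem AnnihilatesMod.length_le [IsNoetherianRing R] {P I : Ideal R} {xs ys : List R}
    (h : AnnihilatesMod P (I ⊔ Ideal.ofList xs))
    (hxs : RegularSeqMod I xs) (hxP : ∀ r ∈ xs, r ∈ P)
    (hys : RegularSeqMod I ys) (hyP : ∀ r ∈ ys, r ∈ P) : ys.length ≤ xs.length := by
  by_contra! hlt
  have hsplit : ys = ys.take xs.length ++ ys[xs.length] :: ys.drop (xs.length + 1) := by simp
  have hys' := hys
  rw [hsplit, regularSeqMod_append] at hys'
  -- The truncation of `ys` to the length of `xs` inherits the annihilated element, but the next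
  -- term of `ys` is regular there.
  refine AnnihilatesMod.not_regularMod (p := ys[xs.length]) ?_ (hyP _ (List.getElem_mem _))
    hys'.2.1
  exact AnnihilatesMod.of_length_eq hxs hxP hys'.1 (fun r hr => hyP r (List.mem_of_mem_take hr))
    (by simp; omega) h

end Rees

/-! ### Regularity of polynomials linear in a fresh variable -/

section FreeVariables

open MvPolynomial

variable {k σ : Type*} [Field k]

/-- The ideal `I` is generated by polynomials in which no variable from `T` occurs. -/
def FreeOf (T : Set σ) (I : Ideal (MvPolynomial σ k)) : Prop :=
  ∃ s : Set (MvPolynomial σ k), I = Ideal.span s ∧ ∀ g ∈ s, g ∈ supported k Tᶜ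

theorem FreeOf.mono {T T' : Set σ} {I : Ideal (MvPolynomial σ k)} (h : FreeOf T I)
    (hT : T' ⊆ T) : FreeOf T' I := by
  obtain ⟨s, rfl, hs⟩ := h
  exact ⟨s, rfl, fun g hg => supported_mono (Set.compl_subset_compl.2 hT) (hs g hg)⟩

theorem freeOf_bot (T : Set σ) : FreeOf T (⊥ : Ideal (MvPolynomial σ k)) :=
  ⟨∅, by simp, by simp⟩

theorem FreeOf.sup {T : Set σ} {I J : Ideal (MvPolynomial σ k)} (hI : FreeOf T I)
    (hJ : FreeOf T J) : FreeOf T (I ⊔ J) := by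
  obtain ⟨s, rfl, hs⟩ := hI
  obtain ⟨t, rfl, ht⟩ := hJ
  refine ⟨s ∪ t, (Ideal.span_union s t).symm, ?_⟩
  rintro g (hg | hg)
  exacts [hs g hg, ht g hg]

theorem freeOf_span_singleton {T : Set σ} {f : MvPolynomial σ k} (hf : f ∈ supported k Tᶜ) :
    FreeOf T (Ideal.span {f}) :=
  ⟨{f}, rfl, by simpa using hf⟩

theorem freeOf_ofList {T : Set σ} {fs : List (MvPolynomial σ k)}
    (hf : ∀ f ∈ fs, f ∈ supported k Tᶜ) : FreeOf T (Ideal.ofList fs) :=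
  ⟨{f | f ∈ fs}, rfl, hf⟩

/-- The polynomial ring as a univariate polynomial ring in the variable `t`. -/
noncomputable def polynomialIn (k : Type*) [Field k] {σ : Type*} [DecidableEq σ] (t : σ) :
    MvPolynomial σ k ≃ₐ[k] Polynomial (MvPolynomial {b // b ≠ t} k) :=
  (renameEquiv k (Equiv.optionSubtypeNe t).symm).trans (optionEquivLeft k _)

theorem polynomialIn_X_self [DecidableEq σ] (t : σ) : polynomialIn k t (X t) = Polynomial.X := by
  simp [polynomialIn]

theorem polynomialIn_rename [DecidableEq σ] (t : σ) (p : MvPolynomial {b // b ≠ t} k) :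
    polynomialIn k t (rename Subtype.val p) = Polynomial.C p := by
  suffices h : ((polynomialIn k t).toAlgHom.comp (rename Subtype.val)) =
      (Algebra.ofId (MvPolynomial {b // b ≠ t} k)
        (Polynomial (MvPolynomial {b // b ≠ t} k))).restrictScalars k from
    DFunLike.congr_fun h p
  ext i : 1
  simp [polynomialIn, Equiv.optionSubtypeNe_symm_of_ne i.2, Algebra.ofId_apply]

/-- The coefficient of degree `n + 1` in the product is `a * gₙ + c * gₙ₊₁`, so the coefficients of
`g` lie in `I` by descending induction from above the degree. -/
theorem regularMod_map_C {A : Type*} [CommRing A] {I : Ideal A} {a : A} (ha : RegularMod I a)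
    (c : A) : RegularMod (I.map Polynomial.C) (Polynomial.C a * Polynomial.X + Polynomial.C c) := by
  intro g hg
  rw [Ideal.mem_map_C_iff] at hg ⊢
  have key : ∀ d n, g.natDegree < n + d → g.coeff n ∈ I := by
    intro d
    induction d with
    | zero =>
      intro n hn
      rw [Polynomial.coeff_eq_zero_of_natDegree_lt (by simpa using hn)]
      exact I.zero_mem
    | succ d ih =>
      intro n hn
      have h1 := ih (n + 1) (by omega)
      have h2 := hg (n + 1)
      rw [add_mul, mul_assoc, Polynomial.coeff_add, Polynomial.coeff_C_mul, Polynomial.coeff_C_mul,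
        Polynomial.coeff_X_mul] at h2
      exact ha _ ((I.add_mem_iff_left (I.mul_mem_left c h1)).1 h2)
  exact fun n => key (g.natDegree + 1) n (by omega)

theorem exists_rename_of_mem_supported {t : σ} {p : MvPolynomial σ k}
    (hp : p ∈ supported k {t}ᶜ) :
    ∃ p' : MvPolynomial {b // b ≠ t} k, rename Subtype.val p' = p :=
  exists_rename_eq_of_vars_subset_range p _ Subtype.val_injective (by
    have := mem_supported.1 hp
    simpa [Set.compl_def] using this)

/-- A polynomial of degree one in `X t` whose leading coefficient is regular modulo an ideal not
involving `X t` is regular modulo that ideal. -/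
theorem FreeOf.regularMod_mul_X_add {t : σ} {I : Ideal (MvPolynomial σ k)} (hI : FreeOf {t} I)
    {a c : MvPolynomial σ k} (ha : a ∈ supported k {t}ᶜ) (hc : c ∈ supported k {t}ᶜ)
    (hreg : RegularMod I a) : RegularMod I (a * X t + c) := by
  classical
  obtain ⟨s, rfl, hs⟩ := hI
  obtain ⟨a, rfl⟩ := exists_rename_of_mem_supported ha
  obtain ⟨c, rfl⟩ := exists_rename_of_mem_supported hc
  set ι : MvPolynomial {b // b ≠ t} k →ₐ[k] MvPolynomial σ k := rename Subtype.val with hι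
  let I' := Ideal.span (ι ⁻¹' s)
  have hII' : Ideal.span s = I'.map ι := by
    rw [Ideal.map_span, Set.image_preimage_eq_of_subset]
    exact fun g hg => exists_rename_of_mem_supported (hs g hg)
  have hmap : (Ideal.span s).map (polynomialIn k t) = I'.map Polynomial.C := by
    rw [hII']
    simp only [I', Ideal.map_span, Set.image_image, hι, polynomialIn_rename]
  have hmem : ∀ f, f ∈ Ideal.span s ↔ polynomialIn k t f ∈ I'.map Polynomial.C := by
    intro f
    rw [← hmap, ← Ideal.mem_comap,
      Ideal.comap_map_of_bijective _ (polynomialIn k t).bijective]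
  -- Regularity descends to the smaller polynomial ring: test on constants in `X t` and read off the
  -- coefficient of degree zero.
  have hreg' : RegularMod I' a := by
    intro g hg
    have h1 := hreg (ι g) (by rw [← map_mul, hII']; exact Ideal.mem_map_of_mem _ hg)
    rw [hmem, hι, polynomialIn_rename, Ideal.mem_map_C_iff] at h1
    simpa using h1 0
  intro g hg
  rw [hmem] at hg ⊢
  rw [map_mul, map_add, map_mul, polynomialIn_X_self, hι, polynomialIn_rename,
    polynomialIn_rename] at hg
  exact regularMod_map_C hreg' c _ hg

theorem regularMod_one (I : Ideal (MvPolynomial σ k)) : RegularMod I 1 :=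
  fun g hg => by simpa using hg

theorem FreeOf.regularMod_X {t : σ} {I : Ideal (MvPolynomial σ k)} (hI : FreeOf {t} I) :
    RegularMod I (X t) := by
  simpa using hI.regularMod_mul_X_add (one_mem _) (zero_mem _) (regularMod_one I)

theorem FreeOf.regularMod_sup_X {t : σ} {I : Ideal (MvPolynomial σ k)} (hI : FreeOf {t} I)
    {a : MvPolynomial σ k} (ha : a ∈ supported k {t}ᶜ) (hreg : RegularMod I a) :
    RegularMod (I ⊔ Ideal.span {X t}) a :=
  hreg.swap (hI.sup (freeOf_span_singleton ha)).regularMod_X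

theorem FreeOf.regularSeqMod_map_X {I : Ideal (MvPolynomial σ k)} {ts : List σ}
    (hI : FreeOf {t | t ∈ ts} I) (hts : ts.Nodup) : RegularSeqMod I (ts.map X) := by
  induction ts generalizing I with
  | nil => trivial
  | cons t ts ih =>
    rw [List.nodup_cons] at hts
    refine ⟨(hI.mono (by simp)).regularMod_X, ih ?_ hts.2⟩
    refine (hI.mono fun _ h => by simp_all).sup (freeOf_span_singleton ?_)
    simpa using hts.1

end FreeVariables

/-! ### Binomials along vertex-disjoint paths form a regular sequence -/

section PathBinomials

open MvPolynomial

variable {k V : Type*} [Field k]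

/-- The binomials of the consecutive pairs of `u :: ws`. -/
noncomputable def pathBinomials (k : Type*) [Field k] {V : Type*} :
    V → List V → List (MvPolynomial (V ⊕ V) k)
  | _, [] => []
  | u, w :: ws => edgeBinomial k u w :: pathBinomials k w ws

/-- The binomials of the consecutive pairs of a list of vertices. -/
noncomputable def listBinomials (k : Type*) [Field k] {V : Type*} :
    List V → List (MvPolynomial (V ⊕ V) k)
  | [] => []
  | u :: ws => pathBinomials k u ws

/-- The variables attached to the vertices in `T`. -/
def vertexVars {V : Type*} (T : Set V) : Set (V ⊕ V) := {t | Sum.elim id id t ∈ T}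

theorem inl_mem_vertexVars {T : Set V} {v : V} : Sum.inl v ∈ vertexVars T ↔ v ∈ T := Iff.rfl

theorem inr_mem_vertexVars {T : Set V} {v : V} : Sum.inr v ∈ vertexVars T ↔ v ∈ T := Iff.rfl

theorem vertexVars_mono {T T' : Set V} (h : T ⊆ T') : vertexVars T ⊆ vertexVars T' :=
  fun _ ht => h ht

theorem edgeBinomial_mem_supported {T : Set V} {i j : V} (hi : i ∉ T) (hj : j ∉ T) :
    edgeBinomial k i j ∈ supported k (vertexVars T)ᶜ := by
  unfold edgeBinomial
  refine sub_mem (mul_mem ?_ ?_) (mul_mem ?_ ?_) <;> simpa [vertexVars]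

theorem exists_of_mem_pathBinomials {u : V} {ws : List V} {f : MvPolynomial (V ⊕ V) k}
    (hf : f ∈ pathBinomials k u ws) : ∃ i ∈ u :: ws, ∃ j ∈ u :: ws, f = edgeBinomial k i j := by
  induction ws generalizing u with
  | nil => simp [pathBinomials] at hf
  | cons w ws ih =>
    rcases List.mem_cons.1 hf with rfl | hf
    · exact ⟨u, by simp, w, by simp, rfl⟩
    · obtain ⟨i, hi, j, hj, rfl⟩ := ih hf
      exact ⟨i, List.mem_cons_of_mem _ hi, j, List.mem_cons_of_mem _ hj, rfl⟩

theorem exists_of_mem_listBinomials {l : List V} {f : MvPolynomial (V ⊕ V) k}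
    (hf : f ∈ listBinomials k l) : ∃ i ∈ l, ∃ j ∈ l, f = edgeBinomial k i j := by
  cases l with
  | nil => simp [listBinomials] at hf
  | cons => exact exists_of_mem_pathBinomials hf

theorem length_pathBinomials (u : V) (ws : List V) :
    (pathBinomials k u ws).length = ws.length := by
  induction ws generalizing u with
  | nil => rfl
  | cons w ws ih => simp [pathBinomials, ih]

theorem length_listBinomials (l : List V) : (listBinomials k l).length = l.length - 1 := by
  cases l with
  | nil => rfl
  | cons => simp [listBinomials, length_pathBinomials]

/-- The binomial is linear in `y_w` with leading coefficient `x_u`. The second conclusion, that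
`x_w` stays regular, is the hypothesis needed for the next edge of the path; it comes from adjoining
`x_w` first and swapping. -/
theorem FreeOf.regularMod_edgeBinomial {I : Ideal (MvPolynomial (V ⊕ V) k)} {u w : V}
    (huw : u ≠ w) (hI : FreeOf (vertexVars {w}) I) (hu : RegularMod I (X (Sum.inl u))) :
    RegularMod I (edgeBinomial k u w) ∧
      RegularMod (I ⊔ Ideal.span {edgeBinomial k u w}) (X (Sum.inl w)) := by
  have hx : FreeOf {Sum.inl w} I := hI.mono (by simp [vertexVars])
  have hy : FreeOf {Sum.inr w} I := hI.mono (by simp [vertexVars])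
  have e : edgeBinomial k u w = X (Sum.inl u) * X (Sum.inr w) +
      -(X (Sum.inl w) * X (Sum.inr u)) := by rw [edgeBinomial, sub_eq_add_neg]
  have h1 : (X (Sum.inl u) : MvPolynomial (V ⊕ V) k) ∈ supported k {Sum.inr w}ᶜ := by simp
  have h2 : -(X (Sum.inl w) * X (Sum.inr u) : MvPolynomial (V ⊕ V) k) ∈
      supported k {Sum.inr w}ᶜ := neg_mem (mul_mem (by simp) (by simpa using huw))
  refine ⟨e ▸ hy.regularMod_mul_X_add h1 h2 hu, hx.regularMod_X.swap ?_⟩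
  rw [e]
  exact (hy.sup (freeOf_span_singleton (by simp))).regularMod_mul_X_add h1 h2
    (hx.regularMod_sup_X (by simpa using huw) hu)

theorem FreeOf.regularSeqMod_pathBinomials {I : Ideal (MvPolynomial (V ⊕ V) k)} {u : V}
    {ws : List V} (hI : FreeOf (vertexVars {w | w ∈ ws}) I) (hws : (u :: ws).Nodup)
    (hu : RegularMod I (X (Sum.inl u))) : RegularSeqMod I (pathBinomials k u ws) := by
  induction ws generalizing u I with
  | nil => trivial
  | cons w ws ih =>
    rw [List.nodup_cons] at hws
    have huw : u ∉ w :: ws := hws.1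
    obtain ⟨h1, h2⟩ := FreeOf.regularMod_edgeBinomial (w := w) (by grind)
      (hI.mono (vertexVars_mono (by simp))) hu
    refine ⟨h1, ih ?_ hws.2 h2⟩
    refine (hI.mono (vertexVars_mono fun _ h => by simp_all)).sup (freeOf_span_singleton
      (edgeBinomial_mem_supported ?_ ?_))
    · grind
    · exact (List.nodup_cons.1 hws.2).1

theorem FreeOf.regularSeqMod_listBinomials {I : Ideal (MvPolynomial (V ⊕ V) k)}
    {l : List V} (hI : FreeOf (vertexVars {w | w ∈ l}) I) (hl : l.Nodup) :
    RegularSeqMod I (listBinomials k l) := by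
  cases l with
  | nil => trivial
  | cons u ws =>
    exact (hI.mono (vertexVars_mono fun _ h => by simp_all)).regularSeqMod_pathBinomials hl
      (hI.mono (by simp [vertexVars])).regularMod_X

theorem FreeOf.regularSeqMod_flatMap {I : Ideal (MvPolynomial (V ⊕ V) k)}
    {L : List (List V)} (hI : FreeOf (vertexVars {w | w ∈ L.flatten}) I) (hL : L.flatten.Nodup) :
    RegularSeqMod I (L.flatMap (listBinomials k)) := by
  induction L generalizing I with
  | nil => trivial
  | cons l L ih =>
    rw [List.flatten_cons, List.nodup_append] at hL
    rw [List.flatMap_cons, regularSeqMod_append]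
    refine ⟨(hI.mono (vertexVars_mono fun _ h => by simp_all)).regularSeqMod_listBinomials hL.1,
      ih ((hI.mono (vertexVars_mono fun _ h => ?_)).sup (freeOf_ofList fun f hf => ?_)) hL.2.1⟩
    · simp_all
    · obtain ⟨i, hi, j, hj, rfl⟩ := exists_of_mem_listBinomials hf
      exact edgeBinomial_mem_supported (fun h => hL.2.2 i hi i h rfl)
        (fun h => hL.2.2 j hj j h rfl)

end PathBinomials

/-! ### Cut ideals and the grade formula -/

section Grade

open MvPolynomial

variable {k V : Type*} [Field k]

theorem edgeBinomial_self (i : V) : edgeBinomial k i i = 0 := sub_self _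

theorem edgeBinomial_swap (i j : V) : edgeBinomial k i j = -edgeBinomial k j i := by
  simp only [edgeBinomial]; ring

/-- Modulo a prime at which the column of `b` does not vanish, being proportional to the column of
`b` is transitive. -/
theorem edgeBinomial_mem_trans {Q : Ideal (MvPolynomial (V ⊕ V) k)} (hQ : Q.IsPrime) {a b c : V}
    (hb : X (Sum.inl b) ∉ Q ∨ X (Sum.inr b) ∉ Q) (hab : edgeBinomial k a b ∈ Q)
    (hbc : edgeBinomial k b c ∈ Q) : edgeBinomial k a c ∈ Q := by
  rcases hb with hb | hb
  · refine (hQ.mem_or_mem (x := X (Sum.inl b)) ?_).resolve_left hb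
    have e : X (Sum.inl b) * edgeBinomial k a c =
        X (Sum.inl a) * edgeBinomial k b c + X (Sum.inl c) * edgeBinomial k a b := by
      simp only [edgeBinomial]; ring
    exact e ▸ Q.add_mem (Q.mul_mem_left _ hbc) (Q.mul_mem_left _ hab)
  · refine (hQ.mem_or_mem (x := X (Sum.inr b)) ?_).resolve_left hb
    have e : X (Sum.inr b) * edgeBinomial k a c =
        X (Sum.inr a) * edgeBinomial k b c + X (Sum.inr c) * edgeBinomial k a b := by
      simp only [edgeBinomial]; ring
    exact e ▸ Q.add_mem (Q.mul_mem_left _ hbc) (Q.mul_mem_left _ hab)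

/-- The ideal generated by the variables of `S` and by all binomials of pairs of vertices outside
`S` with the same colour. -/
noncomputable def cutIdeal (k : Type*) [Field k] {V C : Type*} (S : Set V) (κ : ↥Sᶜ → C) :
    Ideal (MvPolynomial (V ⊕ V) k) :=
  Ideal.span ({f | ∃ v ∈ S, f = X (Sum.inl v) ∨ f = X (Sum.inr v)} ∪
    {f | ∃ i j : ↥Sᶜ, κ i = κ j ∧ f = edgeBinomial k (i : V) j})

theorem X_inl_mem_cutIdeal {C : Type*} {S : Set V} (κ : ↥Sᶜ → C) {v : V} (hv : v ∈ S) :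
    X (Sum.inl v) ∈ cutIdeal k S κ :=
  Ideal.subset_span (Or.inl ⟨v, hv, Or.inl rfl⟩)

theorem X_inr_mem_cutIdeal {C : Type*} {S : Set V} (κ : ↥Sᶜ → C) {v : V} (hv : v ∈ S) :
    X (Sum.inr v) ∈ cutIdeal k S κ :=
  Ideal.subset_span (Or.inl ⟨v, hv, Or.inr rfl⟩)

theorem edgeBinomial_mem_cutIdeal {C : Type*} {S : Set V} {κ : ↥Sᶜ → C} {i j : ↥Sᶜ}
    (h : κ i = κ j) : edgeBinomial k (i : V) j ∈ cutIdeal k S κ :=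
  Ideal.subset_span (Or.inr ⟨i, j, h, rfl⟩)

theorem cutIdeal_le {C : Type*} {S : Set V} {κ : ↥Sᶜ → C} {Q : Ideal (MvPolynomial (V ⊕ V) k)}
    (hS : ∀ v ∈ S, X (Sum.inl v) ∈ Q ∧ X (Sum.inr v) ∈ Q)
    (hκ : ∀ i j : ↥Sᶜ, κ i = κ j → edgeBinomial k (i : V) j ∈ Q) : cutIdeal k S κ ≤ Q := by
  refine Ideal.span_le.2 ?_
  rintro f (⟨v, hv, rfl | rfl⟩ | ⟨i, j, h, rfl⟩)
  exacts [(hS v hv).1, (hS v hv).2, hκ i j h]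

theorem binomialEdgeIdeal_le_cutIdeal (G : SimpleGraph V) (S : Set V) :
    binomialEdgeIdeal k G ≤ cutIdeal k S (G.induce Sᶜ).connectedComponentMk := by
  refine Ideal.span_le.2 ?_
  rintro f ⟨i, j, hij, rfl⟩
  by_cases hi : i ∈ S
  · exact Ideal.sub_mem _ (Ideal.mul_mem_right _ _ (X_inl_mem_cutIdeal _ hi))
      (Ideal.mul_mem_left _ _ (X_inr_mem_cutIdeal _ hi))
  by_cases hj : j ∈ S
  · exact Ideal.sub_mem _ (Ideal.mul_mem_left _ _ (X_inr_mem_cutIdeal _ hj))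
      (Ideal.mul_mem_right _ _ (X_inl_mem_cutIdeal _ hj))
  exact edgeBinomial_mem_cutIdeal (i := ⟨i, hi⟩) (j := ⟨j, hj⟩)
    (SimpleGraph.ConnectedComponent.sound (SimpleGraph.Adj.reachable hij))

/-- Take for `S` the vertices whose column vanishes modulo `Q`. Outside `S` proportionality of
columns is transitive, so it propagates along walks in `G \ S`. -/
theorem exists_cutIdeal_le (G : SimpleGraph V) {Q : Ideal (MvPolynomial (V ⊕ V) k)}
    (hQ : Q.IsPrime) (hG : binomialEdgeIdeal k G ≤ Q) :
    ∃ S : Set V, cutIdeal k S (G.induce Sᶜ).connectedComponentMk ≤ Q := by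
  let S : Set V := {v | X (Sum.inl v) ∈ Q ∧ X (Sum.inr v) ∈ Q}
  refine ⟨S, cutIdeal_le (fun v hv => hv) fun i j hij => ?_⟩
  have hreach := SimpleGraph.ConnectedComponent.exact hij
  rw [SimpleGraph.reachable_iff_reflTransGen] at hreach
  induction hreach with
  | refl => rw [edgeBinomial_self]; exact Q.zero_mem
  | @tail b c hb hbc ih =>
    refine edgeBinomial_mem_trans hQ (not_and_or.1 b.2)
      (ih (SimpleGraph.ConnectedComponent.sound ((SimpleGraph.reachable_iff_reflTransGen _ _).2 hb)))
      (hG (Ideal.subset_span ⟨b, c, hbc, rfl⟩))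

theorem edgeBinomial_mem_of_pathBinomials {Q : Ideal (MvPolynomial (V ⊕ V) k)} (hQ : Q.IsPrime)
    {u : V} {ws : List V} (hx : ∀ w ∈ ws, X (Sum.inl w) ∉ Q)
    (hf : ∀ f ∈ pathBinomials k u ws, f ∈ Q) : ∀ w ∈ ws, edgeBinomial k u w ∈ Q := by
  induction ws generalizing u with
  | nil => simp
  | cons v ws ih =>
    have huv : edgeBinomial k u v ∈ Q := hf _ (by simp [pathBinomials])
    intro w hw
    rcases List.mem_cons.1 hw with rfl | hw
    · exact huv
    · exact edgeBinomial_mem_trans hQ (Or.inl (hx v (by simp))) huv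
        (ih (fun w hw => hx w (by simp [hw])) (fun f hf' => hf f (by simp [pathBinomials, hf']))
          w hw)

theorem edgeBinomial_mem_of_listBinomials {Q : Ideal (MvPolynomial (V ⊕ V) k)} (hQ : Q.IsPrime)
    {l : List V} (hx : ∀ w ∈ l, X (Sum.inl w) ∉ Q)
    (hf : ∀ f ∈ listBinomials k l, f ∈ Q) {i j : V} (hi : i ∈ l) (hj : j ∈ l) :
    edgeBinomial k i j ∈ Q := by
  cases l with
  | nil => simp at hi
  | cons u ws =>
    have key : ∀ w ∈ u :: ws, edgeBinomial k u w ∈ Q := by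
      intro w hw
      rcases List.mem_cons.1 hw with rfl | hw
      · rw [edgeBinomial_self]; exact Q.zero_mem
      · exact edgeBinomial_mem_of_pathBinomials hQ (fun w hw => hx w (by simp [hw])) hf w hw
    refine edgeBinomial_mem_trans hQ (Or.inl (hx u (by simp))) ?_ (key j hj)
    rw [edgeBinomial_swap]
    exact Q.neg_mem (key i hi)

/-- The cut ideal contains a regular sequence of the expected length, modulo which it consists of zerodivisors. -/
theorem exists_regularSeqMod_cutIdeal [Finite V] {C : Type*} (S : Set V) (κ : ↥Sᶜ → C)
    (hκ : Function.Surjective κ) :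
    ∃ fs : List (MvPolynomial (V ⊕ V) k), RegularSeqMod ⊥ fs ∧ (∀ f ∈ fs, f ∈ cutIdeal k S κ) ∧
      AnnihilatesMod (cutIdeal k S κ) (⊥ ⊔ Ideal.ofList fs) ∧
      fs.length + Nat.card C = Nat.card V + S.ncard := by
  classical
  have := Fintype.ofFinite V
  have : Finite C := Finite.of_surjective κ hκ
  have := Fintype.ofFinite C
  let ts : List (V ⊕ V) := (Finset.univ.filter fun t : V ⊕ V => t ∈ vertexVars S).toList
  let block : C → List V := fun c =>
    (Finset.univ.filter fun v : V => ∃ h : v ∈ Sᶜ, κ ⟨v, h⟩ = c).toList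
  let L : List (List V) := (Finset.univ : Finset C).toList.map block
  have mem_ts : ∀ t, t ∈ ts ↔ t ∈ vertexVars S := by simp [ts]
  have mem_block : ∀ c v, v ∈ block c ↔ ∃ h : v ∈ Sᶜ, κ ⟨v, h⟩ = c := by simp [block]
  have mem_flatten : ∀ v, v ∈ L.flatten ↔ v ∈ Sᶜ := by
    intro v
    simp [L, mem_block]
  have nodup_flatten : L.flatten.Nodup := by
    rw [List.nodup_flatten]
    refine ⟨?_, ?_⟩
    · simp only [L, List.mem_map]
      rintro _ ⟨c, -, rfl⟩
      exact Finset.nodup_toList _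
    · refine List.Pairwise.map _ (fun c d (hcd : c ≠ d) v hc hd => ?_) (Finset.nodup_toList _)
      obtain ⟨_, rfl⟩ := (mem_block _ _).1 hc
      obtain ⟨_, rfl⟩ := (mem_block _ _).1 hd
      exact hcd rfl
  -- All variables of `S`, then the binomials along an arbitrary ordering of each colour class,
  -- which need not follow edges of a graph.
  let fs : List (MvPolynomial (V ⊕ V) k) := ts.map X ++ L.flatMap (listBinomials k)
  have mem_fs : ∀ f, f ∈ fs ↔ (∃ v ∈ S, f = X (Sum.inl v) ∨ f = X (Sum.inr v)) ∨
      ∃ c, f ∈ listBinomials k (block c) := by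
    intro f
    simp only [fs, List.mem_append, List.mem_map, mem_ts, List.mem_flatMap, L, Finset.mem_toList,
      Finset.mem_univ, true_and, exists_exists_eq_and]
    refine or_congr ⟨?_, ?_⟩ Iff.rfl
    · rintro ⟨t | t, ht, rfl⟩
      exacts [⟨t, ht, Or.inl rfl⟩, ⟨t, ht, Or.inr rfl⟩]
    · rintro ⟨v, hv, rfl | rfl⟩
      exacts [⟨_, hv, rfl⟩, ⟨_, hv, rfl⟩]
  refine ⟨fs, ?_, ?_, ?_, ?_⟩
  · rw [regularSeqMod_append]
    refine ⟨(freeOf_bot _).regularSeqMod_map_X (Finset.nodup_toList _),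
      FreeOf.regularSeqMod_flatMap ((freeOf_bot _).sup (freeOf_ofList fun f hf => ?_))
        nodup_flatten⟩
    obtain ⟨t, ht, rfl⟩ := List.mem_map.1 hf
    rw [X_mem_supported]
    intro h
    exact (mem_flatten _).1 h ((mem_ts _).1 ht)
  · intro f hf
    rcases (mem_fs f).1 hf with ⟨v, hv, rfl | rfl⟩ | ⟨c, hc⟩
    · exact X_inl_mem_cutIdeal κ hv
    · exact X_inr_mem_cutIdeal κ hv
    · obtain ⟨i, hi, j, hj, rfl⟩ := exists_of_mem_listBinomials hc
      obtain ⟨hi, hi'⟩ := (mem_block _ _).1 hi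
      obtain ⟨hj, hj'⟩ := (mem_block _ _).1 hj
      exact edgeBinomial_mem_cutIdeal (i := ⟨i, hi⟩) (j := ⟨j, hj⟩) (hi'.trans hj'.symm)
  · rw [bot_sup_eq]
    -- Evaluation at a point where `fs` vanishes but no `x_w` with `w ∉ S` does. A minimal prime `Q`
    -- of `(fs)` below its kernel avoids these `x_w`, hence contains every binomial of each class by
    -- transitivity. So the cut ideal lies in the associated prime `Q`, and need not itself be shown
    -- prime.
    let φ : MvPolynomial (V ⊕ V) k →ₐ[k] k :=
      aeval (Sum.elim (fun v => if v ∈ S then 0 else 1) fun _ => 0)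
    have hφ : Ideal.ofList fs ≤ RingHom.ker φ := by
      refine Ideal.span_le.2 fun f hf => ?_
      rw [SetLike.mem_coe, RingHom.mem_ker]
      rcases (mem_fs f).1 hf with ⟨v, hv, rfl | rfl⟩ | ⟨c, hc⟩
      · simp [φ, hv]
      · simp [φ]
      · obtain ⟨i, hi, j, hj, rfl⟩ := exists_of_mem_listBinomials hc
        simp [φ, edgeBinomial]
    have hprime : (RingHom.ker φ).IsPrime := RingHom.ker_isPrime _
    obtain ⟨Q, hQ, hQφ⟩ := Ideal.exists_minimalPrimes_le hφ
    have hQp : Q.IsPrime := hQ.1.1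
    have hass : Q ∈ associatedPrimes (MvPolynomial (V ⊕ V) k)
        (MvPolynomial (V ⊕ V) k ⧸ Ideal.ofList fs) := by
      refine Module.associatedPrimes.minimalPrimes_annihilator_subset_associatedPrimes _ _ ?_
      rwa [Ideal.annihilator_quotient]
    obtain ⟨m, hm, hQm⟩ := IsAssociatedPrime.annihilatesMod (AssociatedPrimes.mem_iff.1 hass)
    refine ⟨m, hm, fun p hp => hQm p (cutIdeal_le ?_ ?_ hp)⟩
    · intro v hv
      exact ⟨hQ.1.2 (Ideal.subset_span ((mem_fs _).2 (Or.inl ⟨v, hv, Or.inl rfl⟩))),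
        hQ.1.2 (Ideal.subset_span ((mem_fs _).2 (Or.inl ⟨v, hv, Or.inr rfl⟩)))⟩
    · intro i j hij
      refine edgeBinomial_mem_of_listBinomials hQp (l := block (κ i)) ?_ ?_
        ((mem_block _ _).2 ⟨i.2, rfl⟩) ((mem_block _ _).2 ⟨j.2, hij.symm⟩)
      · intro w hw hwQ
        obtain ⟨hwS, -⟩ := (mem_block _ _).1 hw
        have := hQφ hwQ
        rw [RingHom.mem_ker] at this
        have hwS' : w ∉ S := hwS
        simp [φ, hwS'] at this
      · exact fun f hf => hQ.1.2 (Ideal.subset_span ((mem_fs _).2 (Or.inr ⟨_, hf⟩)))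
  -- The length is `2|S|` plus `|B| - 1` for each colour class `B`; the classes are nonempty because
  -- `κ` is surjective, so the truncated subtraction is harmless.
  · have hts : ts.length = 2 * S.ncard := by
      have e : (Finset.univ.filter fun t : V ⊕ V => t ∈ vertexVars S) =
          (Finset.univ.filter (· ∈ S)).disjSum (Finset.univ.filter (· ∈ S)) := by
        ext (t | t) <;> simp [inl_mem_vertexVars, inr_mem_vertexVars]
      rw [Finset.length_toList, e, Finset.card_disjSum, Set.ncard_eq_toFinset_card' S,
        ← two_mul]
      congr 2
      ext; simp
    have hLlen : L.length = Nat.card C := by simp [L]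
    have hflat : L.flatten.length + S.ncard = Nat.card V := by
      rw [← Set.ncard_add_ncard_compl S, add_comm, ← List.toFinset_card_of_nodup nodup_flatten,
        ← Set.ncard_coe_finset]
      congr 2
      ext v
      simpa using mem_flatten v
    have hne : ∀ l ∈ L, 1 ≤ l.length := by
      simp only [L, List.mem_map]
      rintro _ ⟨c, -, rfl⟩
      obtain ⟨v, hv⟩ := hκ c
      exact List.length_pos_of_mem ((mem_block c v).2 ⟨v.2, hv⟩)
    have hsum : ∀ L : List (List V), (∀ l ∈ L, 1 ≤ l.length) →
        (L.flatMap (listBinomials k)).length + L.length = L.flatten.length := by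
      intro L hL
      induction L with
      | nil => rfl
      | cons l L ih =>
        have h1 := ih fun l hl => hL l (by simp [hl])
        have h2 := hL l (by simp)
        simp only [List.flatMap_cons, List.length_append, List.length_cons, List.flatten_cons,
          length_listBinomials]
        omega
    have := hsum L hne
    simp only [fs, List.length_append, List.length_map]
    omega

theorem length_add_card_le_of_regularSeqMod [Finite V] (G : SimpleGraph V) (S : Set V)
    {rs : List (MvPolynomial (V ⊕ V) k)} (hrs : RegularSeqMod ⊥ rs)
    (hG : ∀ r ∈ rs, r ∈ binomialEdgeIdeal k G) :
    rs.length + Nat.card (G.induce Sᶜ).ConnectedComponent ≤ Nat.card V + S.ncard := by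
  obtain ⟨fs, h1, h2, h3, h4⟩ := exists_regularSeqMod_cutIdeal (k := k) S
    (G.induce Sᶜ).connectedComponentMk Quot.mk_surjective
  have := h3.length_le h1 h2 hrs fun r hr => binomialEdgeIdeal_le_cutIdeal G S (hG r hr)
  omega

/-- The grade of the binomial edge ideal is the smallest of the numbers
`|V| + |S| - c(G \ S)`. -/
theorem exists_idealGrade_add_card [Finite V] (G : SimpleGraph V) :
    ∃ g : ℕ, idealGrade (binomialEdgeIdeal k G) = g ∧
      (∀ S : Set V, g + Nat.card (G.induce Sᶜ).ConnectedComponent ≤ Nat.card V + S.ncard) ∧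
      ∃ S : Set V, g + Nat.card (G.induce Sᶜ).ConnectedComponent = Nat.card V + S.ncard := by
  let lengths : Set ℕ := {n | ∃ rs : List (MvPolynomial (V ⊕ V) k),
    RingTheory.Sequence.IsRegular (MvPolynomial (V ⊕ V) k) rs ∧
      (∀ r ∈ rs, r ∈ binomialEdgeIdeal k G) ∧ rs.length = n}
  have hbound : ∀ n ∈ lengths, ∀ S : Set V,
      n + Nat.card (G.induce Sᶜ).ConnectedComponent ≤ Nat.card V + S.ncard := by
    rintro n ⟨rs, hrs, hG, rfl⟩ S
    exact length_add_card_le_of_regularSeqMod G S (isRegular_iff_regularSeqMod.1 hrs).1 hG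
  -- The bound for `S = ∅` already gives length at most `|V|`.
  have hbdd : BddAbove lengths := ⟨Nat.card V, fun n hn => by
    have := hbound n hn ∅
    simp only [Set.ncard_empty] at this
    omega⟩
  have hne : lengths.Nonempty := ⟨0, [], RingTheory.Sequence.IsRegular.nil _ _, by simp, rfl⟩
  obtain ⟨rs, hrs, hG, hlen⟩ := Nat.sSup_mem hne hbdd
  have hmax : ∀ n ∈ lengths, n ≤ rs.length := fun n hn => hlen ▸ le_csSup hbdd hn
  refine ⟨rs.length, le_antisymm ?_ ?_, hbound _ ⟨rs, hrs, hG, rfl⟩, ?_⟩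
  · exact iSup_le fun bs => iSup_le fun hbs => iSup_le fun hb =>
      Nat.cast_le.2 (hmax _ ⟨bs, hbs, hb, rfl⟩)
  · exact le_iSup_of_le rs (le_iSup_of_le hrs (le_iSup_of_le hG le_rfl))
  · rw [isRegular_iff_regularSeqMod] at hrs
    have hzero : ∀ p ∈ binomialEdgeIdeal k G, ¬ RegularMod (Ideal.ofList rs) p := by
      intro p hp hreg
      have hmem : ∀ r ∈ rs ++ [p], r ∈ binomialEdgeIdeal k G := by
        intro r hr
        rcases List.mem_append.1 hr with hr | hr
        · exact hG r hr
        · rwa [List.mem_singleton.1 hr]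
      -- `J(G)` is proper, since it lies in the cut ideal of `∅`, which annihilates an element
      -- nonzero modulo some ideal.
      have hproper : Ideal.ofList (rs ++ [p]) ≠ ⊤ := by
        obtain ⟨fs, -, -, ⟨m, hm, hP⟩, -⟩ := exists_regularSeqMod_cutIdeal (k := k) ∅
          (G.induce ∅ᶜ).connectedComponentMk Quot.mk_surjective
        intro htop
        have h1 : (1 : MvPolynomial (V ⊕ V) k) ∈ binomialEdgeIdeal k G :=
          Ideal.span_le.2 hmem (show (1 : MvPolynomial (V ⊕ V) k) ∈ Ideal.ofList (rs ++ [p]) by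
            rw [htop]; trivial)
        exact hm (by simpa using hP 1 (binomialEdgeIdeal_le_cutIdeal G ∅ h1))
      have := hmax _ ⟨rs ++ [p], isRegular_iff_regularSeqMod.2
        ⟨regularSeqMod_append.2 ⟨hrs.1, by rwa [bot_sup_eq], trivial⟩, hproper⟩, hmem, rfl⟩
      simp at this
    obtain ⟨-, -, Q, hQ, hle, hann⟩ := exists_le_associated_of_forall_not_regularMod {()}
      (fun _ => Ideal.ofList rs) fun p hp => ⟨(), by simp, hzero p hp⟩
    obtain ⟨S, hS⟩ := exists_cutIdeal_le G hQ hle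
    obtain ⟨fs, h1, h2, -, h4⟩ := exists_regularSeqMod_cutIdeal (k := k) S
      (G.induce Sᶜ).connectedComponentMk Quot.mk_surjective
    -- Rees' theorem in `Q`: the sequence `rs` is already maximal there, so the sequence from the
    -- cut ideal of `S` cannot be longer. With the upper bound `h6` this gives equality at `S`.
    have h5 := AnnihilatesMod.length_le (I := ⊥) (by rwa [bot_sup_eq]) hrs.1
      (fun r hr => hle (hG r hr)) h1 fun r hr => hS (h2 r hr)
    have h6 := hbound _ ⟨rs, isRegular_iff_regularSeqMod.2 hrs, hG, rfl⟩ S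
    exact ⟨S, by omega⟩

end Grade

/-! ### Edge counts and components of linear forests -/

section Forests

variable {V : Type*}

theorem reachable_of_reachable_deleteEdge {F : SimpleGraph V} {u v a b : V}
    (h : F.Reachable a b) :
    (F.deleteEdges {s(u, v)}).Reachable a b ∨
      ((F.deleteEdges {s(u, v)}).Reachable a u ∧ (F.deleteEdges {s(u, v)}).Reachable v b) ∨
      ((F.deleteEdges {s(u, v)}).Reachable a v ∧ (F.deleteEdges {s(u, v)}).Reachable u b) := by
  rw [SimpleGraph.reachable_iff_reflTransGen] at h
  induction h with
  | refl => exact Or.inl (SimpleGraph.Reachable.refl _)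
  | @tail x y _ hxy ih =>
    by_cases he : s(x, y) = s(u, v)
    · rcases Sym2.eq_iff.1 he with ⟨rfl, rfl⟩ | ⟨rfl, rfl⟩
      · rcases ih with h | ⟨h, -⟩ | ⟨h, -⟩
        · exact Or.inr (Or.inl ⟨h, SimpleGraph.Reachable.refl _⟩)
        · exact Or.inr (Or.inl ⟨h, SimpleGraph.Reachable.refl _⟩)
        · exact Or.inl h
      · rcases ih with h | ⟨h, -⟩ | ⟨h, -⟩
        · exact Or.inr (Or.inr ⟨h, SimpleGraph.Reachable.refl _⟩)
        · exact Or.inl h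
        · exact Or.inr (Or.inr ⟨h, SimpleGraph.Reachable.refl _⟩)
    · have hadj : (F.deleteEdges {s(u, v)}).Reachable x y :=
        SimpleGraph.Adj.reachable ((SimpleGraph.deleteEdges_adj).2 ⟨hxy, he⟩)
      rcases ih with h | ⟨h, h'⟩ | ⟨h, h'⟩
      · exact Or.inl (h.trans hadj)
      · exact Or.inr (Or.inl ⟨h, h'.trans hadj⟩)
      · exact Or.inr (Or.inr ⟨h, h'.trans hadj⟩)

theorem card_connectedComponent_deleteEdge [Finite V] {F : SimpleGraph V} {u v : V}
    (huv : F.Adj u v) (hbridge : ¬ (F.deleteEdges {s(u, v)}).Reachable u v) :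
    Nat.card (F.deleteEdges {s(u, v)}).ConnectedComponent =
      Nat.card F.ConnectedComponent + 1 := by
  classical
  set F' := F.deleteEdges {s(u, v)} with hF'
  have hle : F' ≤ F := SimpleGraph.deleteEdges_le _
  -- Removing the bridge splits one component into those of `u` and `v`; discarding the one of `v`
  -- makes the map to the components of `F` bijective.
  let e : {c : F'.ConnectedComponent // c ≠ F'.connectedComponentMk v} ≃ F.ConnectedComponent :=
    Equiv.ofBijective (fun c => c.1.map (SimpleGraph.Hom.ofLE hle)) (by
      constructor
      · rintro ⟨c, hc⟩ ⟨d, hd⟩ h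
        induction c using SimpleGraph.ConnectedComponent.ind with | _ a
        induction d using SimpleGraph.ConnectedComponent.ind with | _ b
        have hab : F.Reachable a b := SimpleGraph.ConnectedComponent.exact h
        rw [Subtype.mk.injEq]
        refine SimpleGraph.ConnectedComponent.sound ?_
        rcases reachable_of_reachable_deleteEdge (u := u) (v := v) hab with h | ⟨-, h⟩ | ⟨h, -⟩
        · exact h
        · exact absurd (SimpleGraph.ConnectedComponent.sound h.symm) hd
        · exact absurd (SimpleGraph.ConnectedComponent.sound h) hc
      · intro c
        induction c using SimpleGraph.ConnectedComponent.ind with | _ a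
        by_cases ha : F'.Reachable a v
        · refine ⟨⟨F'.connectedComponentMk u,
            fun h => hbridge (SimpleGraph.ConnectedComponent.exact h)⟩,
            SimpleGraph.ConnectedComponent.sound ?_⟩
          exact huv.reachable.trans (ha.mono hle).symm
        · exact ⟨⟨F'.connectedComponentMk a,
            fun h => ha (SimpleGraph.ConnectedComponent.exact h)⟩, rfl⟩)
  have := Fintype.ofFinite F'.ConnectedComponent
  rw [← Nat.card_congr e, Nat.card_eq_fintype_card, Nat.card_eq_fintype_card,
    Fintype.card_subtype_compl, Fintype.card_subtype_eq]
  have : 0 < Fintype.card F'.ConnectedComponent :=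
    Fintype.card_pos_iff.2 ⟨F'.connectedComponentMk v⟩
  omega

theorem SimpleGraph.IsAcyclic.ncard_edgeSet_add_card [Finite V] {F : SimpleGraph V}
    (hF : F.IsAcyclic) : F.edgeSet.ncard + Nat.card F.ConnectedComponent = Nat.card V := by
  induction hn : F.edgeSet.ncard generalizing F with
  | zero =>
    rw [Set.ncard_eq_zero, SimpleGraph.edgeSet_eq_empty] at hn
    subst hn
    rw [zero_add]
    refine (Nat.card_congr (Equiv.ofBijective
      (SimpleGraph.connectedComponentMk ⊥) ⟨fun a b h => ?_, Quot.mk_surjective⟩)).symm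
    exact SimpleGraph.reachable_bot.1 (SimpleGraph.ConnectedComponent.exact h)
  | succ n ih =>
    have hne : F.edgeSet.Nonempty := by
      rw [← Set.ncard_pos, hn]; omega
    obtain ⟨e, he⟩ := hne
    induction e using Sym2.ind with | _ u v
    have hbridge := SimpleGraph.isAcyclic_iff_forall_isBridge.1 hF he
    rw [SimpleGraph.isBridge_iff] at hbridge
    have hcard : (F.deleteEdges {s(u, v)}).edgeSet.ncard = n := by
      rw [SimpleGraph.edgeSet_deleteEdges, Set.ncard_sdiff_singleton_of_mem he, hn]
      rfl
    have h1 := ih (hF.anti (SimpleGraph.deleteEdges_le _)) hcard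
    have h2 := card_connectedComponent_deleteEdge (u := u) (v := v) he hbridge
    omega

/-- Positions along the path that is the component of `v` in a linear forest. -/
theorem IsLinearForest.exists_position {F : SimpleGraph V} (hF : IsLinearForest F) (v : V) :
    ∃ pos : V → ℕ, (∀ x y, F.Reachable v x → F.Reachable v y → pos x = pos y → x = y) ∧
      ∀ x y, F.Reachable v x → F.Adj x y → pos x + 1 = pos y ∨ pos y + 1 = pos x := by
  classical
  obtain ⟨m, ⟨φ⟩⟩ := hF (F.connectedComponentMk v)
  have hmem : ∀ x, F.Reachable v x ↔ x ∈ F.connectedComponentMk v := fun x =>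
    ⟨fun h => SimpleGraph.ConnectedComponent.sound h.symm,
      fun h => (SimpleGraph.ConnectedComponent.exact h).symm⟩
  refine ⟨fun x => if h : x ∈ F.connectedComponentMk v then (φ ⟨x, h⟩ : ℕ) else 0, ?_, ?_⟩
  · intro x y hx hy h
    rw [hmem] at hx hy
    simp only [hx, hy, dif_pos] at h
    simpa using φ.injective (Fin.ext h)
  · intro x y hx hxy
    have hy : F.Reachable v y := hx.trans hxy.reachable
    rw [hmem] at hx hy
    simp only [hx, hy, dif_pos]
    have : (SimpleGraph.pathGraph m).Adj (φ ⟨x, hx⟩) (φ ⟨y, hy⟩) := φ.map_rel_iff.2 hxy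
    exact SimpleGraph.pathGraph_adj.1 this

/-- Every edge is a bridge: positions along a path change by one at each step, so without the edge
from position `p` to `p + 1` no walk gets from positions at most `p` to larger ones. -/
theorem IsLinearForest.isAcyclic {F : SimpleGraph V} (hF : IsLinearForest F) : F.IsAcyclic := by
  rw [SimpleGraph.isAcyclic_iff_forall_isBridge]
  intro e he
  obtain ⟨u, v, rfl, huv⟩ : ∃ u v, e = s(u, v) ∧ F.Adj u v := by
    induction e using Sym2.ind with | _ u v
    exact ⟨u, v, rfl, he⟩
  obtain ⟨pos, hinj, hadj⟩ := hF.exists_position u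
  have key : ∀ a b, F.Reachable u a → F.Adj a b → pos a + 1 = pos b →
      ¬ (F.deleteEdges {s(a, b)}).Reachable a b := by
    intro a b ha hab hpos hreach
    have hb := ha.trans hab.reachable
    have inv : ∀ x, (F.deleteEdges {s(a, b)}).Reachable a x → F.Reachable u x ∧ pos x ≤ pos a := by
      intro x hx
      rw [SimpleGraph.reachable_iff_reflTransGen] at hx
      induction hx with
      | refl => exact ⟨ha, le_rfl⟩
      | @tail x y _ hxy ih =>
        obtain ⟨hx, hle⟩ := ih
        rw [SimpleGraph.deleteEdges_adj] at hxy
        have hy := hx.trans hxy.1.reachable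
        refine ⟨hy, ?_⟩
        by_contra! hlt
        rcases hadj x y hx hxy.1 with h | h
        · have e1 : x = a := hinj x a hx ha (by omega)
          have e2 : y = b := hinj y b hy hb (by omega)
          exact hxy.2 (by rw [e1, e2]; rfl)
        · omega
    have := (inv b hreach).2
    omega
  rw [SimpleGraph.isBridge_iff]
  have hu : F.Reachable u u := SimpleGraph.Reachable.refl _
  rcases hadj u v hu huv with h | h
  · exact key u v hu huv h
  · intro hr
    refine key v u huv.reachable huv.symm h ?_
    rw [Sym2.eq_swap]
    exact hr.symm

theorem IsLinearForest.encard_neighborSet_le {F : SimpleGraph V} (hF : IsLinearForest F) (v : V) :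
    (F.neighborSet v).encard ≤ 2 := by
  obtain ⟨pos, hinj, hadj⟩ := hF.exists_position v
  have hv : F.Reachable v v := SimpleGraph.Reachable.refl _
  have hinj' : Set.InjOn pos (F.neighborSet v) := fun x hx y hy h =>
    hinj x y (SimpleGraph.Adj.reachable hx) (SimpleGraph.Adj.reachable hy) h
  rw [← hinj'.encard_image]
  -- At `pos v = 0` the truncated `pos v - 1` is a spurious value, harmless for an upper bound.
  refine (Set.encard_le_encard (t := {pos v + 1, pos v - 1}) ?_).trans (Set.encard_insert_le _ _ |>.trans ?_)
  swap
  · rw [Set.encard_singleton]; norm_num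
  rintro _ ⟨x, hx, rfl⟩
  rcases hadj v x hv hx with h | h
  · exact Or.inl h.symm
  · exact Or.inr (by rw [Set.mem_singleton_iff]; omega)

theorem ncard_edgeSet_induce [Finite V] (F : SimpleGraph V) (S : Set V) :
    (F.induce Sᶜ).edgeSet.ncard = {e ∈ F.edgeSet | ∀ v ∈ e, v ∉ S}.ncard := by
  rw [← Set.ncard_image_of_injective _ (Sym2.map.injective (Subtype.val_injective (p := (· ∈ Sᶜ))))]
  congr 1
  ext e
  constructor
  · rintro ⟨e, he, rfl⟩
    induction e using Sym2.ind with | _ u v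
    refine ⟨he, ?_⟩
    intro w hw
    rcases Sym2.mem_iff.1 hw with rfl | rfl
    exacts [u.2, v.2]
  · induction e using Sym2.ind with | _ u v
    rintro ⟨he, h⟩
    exact ⟨s(⟨u, h u (Sym2.mem_mk_left _ _)⟩, ⟨v, h v (Sym2.mem_mk_right _ _)⟩), he, rfl⟩

/-- Deleting `S` from a graph of maximal degree at most two removes at most `2 |S|` edges, with
equality if and only if `S` is independent and all its vertices have degree two. -/
theorem ncard_edgeSet_le_induce [Finite V] {F : SimpleGraph V}
    (hdeg : ∀ v, (F.neighborSet v).encard ≤ 2) (S : Set V) :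
    F.edgeSet.ncard ≤ (F.induce Sᶜ).edgeSet.ncard + 2 * S.ncard ∧
      (F.edgeSet.ncard = (F.induce Sᶜ).edgeSet.ncard + 2 * S.ncard ↔
        (∀ v ∈ S, ¬ IsLeaf F v) ∧ ∀ v ∈ S, ∀ w ∈ S, ¬ F.Adj v w) := by
  classical
  have := Fintype.ofFinite V
  let T : Finset V := S.toFinset
  -- Oriented edges starting in `S`, at most `2|S|` of them, with equality exactly when all degrees
  -- on `S` are two. Forgetting orientation maps them onto the deleted edges, injectively exactly
  -- when `S` is independent.
  let D : Finset (Σ _ : V, V) := T.sigma fun v => F.neighborFinset v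
  let f : (Σ _ : V, V) → Sym2 V := fun p => s(p.1, p.2)
  have hdeg' : ∀ v, F.degree v ≤ 2 := fun v => by
    have := hdeg v
    rw [Set.encard_eq_coe_toFinset_card] at this
    exact_mod_cast this
  have hleaf : ∀ v, ¬ IsLeaf F v ↔ F.degree v = 2 := fun v => by
    have h1 : IsLeaf F v ↔ F.degree v ≤ 1 := by
      rw [IsLeaf, Set.encard_eq_coe_toFinset_card]
      exact_mod_cast Iff.rfl
    rw [h1]
    have := hdeg' v
    omega
  have hT : T.card = S.ncard := (Set.ncard_eq_toFinset_card' S).symm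
  have hsplit : F.edgeSet.ncard = (F.induce Sᶜ).edgeSet.ncard + (D.image f).card := by
    rw [ncard_edgeSet_induce, ← Set.ncard_coe_finset, ← Set.ncard_union_eq]
    · congr 1
      ext e
      induction e using Sym2.ind with | _ u v
      simp only [Set.mem_union, Set.mem_ofPred_eq, SimpleGraph.mem_edgeSet, Sym2.mem_iff,
        forall_eq_or_imp, forall_eq, Finset.coe_image, Set.mem_image, Finset.mem_coe, D, f, T,
        Finset.mem_sigma, Set.mem_toFinset, SimpleGraph.mem_neighborFinset, Sigma.exists,
        Sym2.eq_iff]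
      constructor
      · intro h
        by_cases hu : u ∈ S
        · exact Or.inr ⟨u, v, ⟨hu, h⟩, Or.inl ⟨rfl, rfl⟩⟩
        by_cases hv : v ∈ S
        · exact Or.inr ⟨v, u, ⟨hv, h.symm⟩, Or.inr ⟨rfl, rfl⟩⟩
        · exact Or.inl ⟨h, hu, hv⟩
      · rintro (⟨h, -⟩ | ⟨a, b, ⟨-, h⟩, ⟨rfl, rfl⟩ | ⟨rfl, rfl⟩⟩)
        exacts [h, h, h.symm]
    · rw [Set.disjoint_left]
      rintro e ⟨-, he⟩ h
      simp only [Finset.coe_image, Set.mem_image, Finset.mem_coe, D, T, Finset.mem_sigma,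
        Set.mem_toFinset] at h
      obtain ⟨p, hp, rfl⟩ := h
      exact he p.1 (Sym2.mem_mk_left _ _) hp.1
  have hD : D.card = ∑ v ∈ T, F.degree v := Finset.card_sigma _ _
  have hsum : ∑ v ∈ T, F.degree v ≤ ∑ _v ∈ T, 2 := Finset.sum_le_sum fun v _ => hdeg' v
  have htwo : ∑ _v ∈ T, 2 = 2 * S.ncard := by rw [Finset.sum_const, hT, smul_eq_mul, mul_comm]
  have himg : (D.image f).card ≤ D.card := Finset.card_image_le
  have hinj : Set.InjOn f D ↔ ∀ v ∈ S, ∀ w ∈ S, ¬ F.Adj v w := by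
    constructor
    · intro h v hv w hw hvw
      have h1 : (⟨v, w⟩ : Σ _ : V, V) ∈ (D : Set (Σ _ : V, V)) := by simp [D, T, hv, hvw]
      have h2 : (⟨w, v⟩ : Σ _ : V, V) ∈ (D : Set (Σ _ : V, V)) := by simp [D, T, hw, hvw.symm]
      have := h h1 h2 Sym2.eq_swap
      exact hvw.ne (congrArg Sigma.fst this)
    · rintro h ⟨a, b⟩ hab ⟨c, d⟩ hcd he
      simp only [D, T, Finset.coe_sigma, Set.mem_sigma_iff, Finset.mem_coe, Set.mem_toFinset,
        SimpleGraph.mem_neighborFinset] at hab hcd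
      rcases Sym2.eq_iff.1 he with ⟨h1, h2⟩ | ⟨h1, h2⟩
      · simp only at h1 h2
        rw [h1, h2]
      · simp only at h1 h2
        subst h1 h2
        exact absurd hab.2 (h _ hab.1 _ hcd.1)
  refine ⟨by omega, ?_⟩
  rw [← hinj, ← Finset.card_image_iff]
  constructor
  · intro h
    refine ⟨fun v hv => (hleaf v).2 ?_, by omega⟩
    have heq : ∑ v ∈ T, F.degree v = ∑ _v ∈ T, 2 := by omega
    exact (Finset.sum_eq_sum_iff_of_le fun v _ => hdeg' v).1 heq v (Set.mem_toFinset.2 hv)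
  · rintro ⟨h1, h2⟩
    have : ∑ v ∈ T, F.degree v = ∑ _v ∈ T, 2 :=
      Finset.sum_congr rfl fun v hv => (hleaf v).1 (h1 v (Set.mem_toFinset.1 hv))
    omega

/-- The map on components induced by `H ≤ K` is surjective, so for finite `V` equal cardinality
means injectivity, which can be tested on the edges of `K`. -/
theorem card_connectedComponent_eq_iff [Finite V] {H K : SimpleGraph V} (h : H ≤ K) :
    Nat.card K.ConnectedComponent = Nat.card H.ConnectedComponent ↔
      ∀ i j, K.Adj i j → H.Reachable i j := by
  let π : H.ConnectedComponent → K.ConnectedComponent := fun c =>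
    c.map (SimpleGraph.Hom.ofLE h)
  have hsurj : Function.Surjective π := SimpleGraph.ConnectedComponent.surjective_map_ofLE h
  constructor
  · intro hcard i j hij
    have hinj : Function.Injective π := (hsurj.bijective_of_nat_card_le hcard.ge).1
    exact SimpleGraph.ConnectedComponent.exact
      (@hinj (H.connectedComponentMk i) (H.connectedComponentMk j)
        (SimpleGraph.ConnectedComponent.sound hij.reachable))
  · intro hadj
    refine (Nat.card_congr (Equiv.ofBijective π ⟨fun c d hcd => ?_, hsurj⟩)).symm
    induction c using SimpleGraph.ConnectedComponent.ind with | _ a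
    induction d using SimpleGraph.ConnectedComponent.ind with | _ b
    have hab : K.Reachable a b := SimpleGraph.ConnectedComponent.exact hcd
    refine SimpleGraph.ConnectedComponent.sound ?_
    rw [SimpleGraph.reachable_iff_reflTransGen] at hab
    induction hab with
    | refl => exact SimpleGraph.Reachable.refl _
    | @tail x y hx hxy ih =>
      exact (ih (SimpleGraph.ConnectedComponent.sound
        ((SimpleGraph.reachable_iff_reflTransGen _ _).2 hx))).trans (hadj x y hxy)

/-- |E(F)| ≤ |E(F \ S)| + 2|S| = |V| - |S| - c(F \ S) + 2|S| ≤ |V| + |S| - c(G \ S). -/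
theorem IsLinearForest.ncard_edgeSet_add_card_le [Finite V] {G F : SimpleGraph V}
    (hF : IsLinearForest F) (hle : F ≤ G) (S : Set V) :
    F.edgeSet.ncard + Nat.card (G.induce Sᶜ).ConnectedComponent ≤ Nat.card V + S.ncard := by
  have h1 := (ncard_edgeSet_le_induce hF.encard_neighborSet_le S).1
  have h2 := (hF.isAcyclic.induce Sᶜ).ncard_edgeSet_add_card
  have h3 : Nat.card (G.induce Sᶜ).ConnectedComponent ≤
      Nat.card (F.induce Sᶜ).ConnectedComponent :=
    SimpleGraph.ConnectedComponent.card_le_card_of_le (SimpleGraph.comap_monotone _ hle)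
  have h4 := Set.ncard_add_ncard_compl S
  have h5 : Nat.card ↥Sᶜ = Sᶜ.ncard := rfl
  omega

/-- Equality in the bound means equality in both of its estimates. The edge estimate encodes
conditions (1) and (2) of a cover, the component estimate condition (3). -/
theorem IsMaximalLinearForest.isLFCover_iff [Finite V] {G F : SimpleGraph V}
    (hF : IsMaximalLinearForest G F) (S : Set V) :
    IsLFCover G F S ↔
      F.edgeSet.ncard + Nat.card (G.induce Sᶜ).ConnectedComponent = Nat.card V + S.ncard := by
  obtain ⟨h1, h1'⟩ := ncard_edgeSet_le_induce hF.isLinearForest.encard_neighborSet_le S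
  have h2 := (hF.isLinearForest.isAcyclic.induce Sᶜ).ncard_edgeSet_add_card
  have hle : F.induce Sᶜ ≤ G.induce Sᶜ := SimpleGraph.comap_monotone _ hF.le
  have h3 := SimpleGraph.ConnectedComponent.card_le_card_of_le hle
  have h3' := card_connectedComponent_eq_iff hle
  have h4 := Set.ncard_add_ncard_compl S
  have h5 : Nat.card ↥Sᶜ = Sᶜ.ncard := rfl
  constructor
  · intro h
    have e1 := h1'.2 ⟨h.not_leaf, h.not_adj⟩
    have e2 := h3'.2 fun i j hij => by
      rcases h.covers i j hij with (hi | hj) | ⟨_, _, h⟩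
      exacts [absurd hi i.2, absurd hj j.2, h]
    omega
  · intro h
    obtain ⟨hl, ha⟩ := h1'.1 (by omega)
    have hr := h3'.1 (by omega)
    refine ⟨hF, hl, ha, fun i j hij => ?_⟩
    by_cases hi : i ∈ S
    · exact Or.inl (Or.inl hi)
    by_cases hj : j ∈ S
    · exact Or.inl (Or.inr hj)
    exact Or.inr ⟨hi, hj, hr ⟨i, hi⟩ ⟨j, hj⟩ hij⟩

theorem isLinearForest_bot : IsLinearForest (⊥ : SimpleGraph V) := by
  intro c
  induction c using SimpleGraph.ConnectedComponent.ind with | _ v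
  have hv : ∀ x : (SimpleGraph.connectedComponentMk ⊥ v), x.1 = v := fun x =>
    SimpleGraph.reachable_bot.1 (SimpleGraph.ConnectedComponent.exact x.2)
  refine ⟨1, ⟨⟨⟨fun _ => 0, fun _ => ⟨v, rfl⟩, fun x => Subtype.ext (hv x).symm,
    fun x => Subsingleton.elim _ _⟩, ?_⟩⟩⟩
  intro a b
  constructor
  · intro h
    exact absurd (Subsingleton.elim _ _) h.ne
  · intro h
    exact absurd h (by simp [SimpleGraph.ConnectedComponent.toSimpleGraph])

theorem exists_isMaximalLinearForest [Finite V] (G : SimpleGraph V) :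
    ∃ F, IsMaximalLinearForest G F := by
  obtain ⟨F, ⟨hle, hF⟩, hmax⟩ := Set.exists_max_image
    {F : SimpleGraph V | F ≤ G ∧ IsLinearForest F} (fun F => F.edgeSet.encard) (Set.toFinite _)
    ⟨⊥, bot_le, isLinearForest_bot⟩
  exact ⟨F, hle, hF, fun F' h h' => hmax F' ⟨h, h'⟩⟩

theorem IsMaximalLinearForest.LF_eq [Finite V] {G F : SimpleGraph V}
    (hF : IsMaximalLinearForest G F) : LF G = F.edgeSet.ncard := by
  rw [(Set.toFinite F.edgeSet).cast_ncard_eq]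
  refine le_antisymm (iSup_le fun F' => iSup_le fun h => iSup_le fun h' => hF.maximal F' h h') ?_
  exact le_iSup_of_le F (le_iSup_of_le hF.le (le_iSup_of_le hF.isLinearForest le_rfl))

end Forests

theorem mainTheorem1 (k : Type*) [Field k] {V : Type*} [Finite V] (G : SimpleGraph V) :
    (IsKonigType k G ↔ IsLFCoverable G) ∧
    (∀ F F' : SimpleGraph V, IsMaximalLinearForest G F → IsMaximalLinearForest G F' →
      ∀ S : Set V, IsLFCover G F S ↔ IsLFCover G F' S) := by
  refine ⟨?_, fun F F' hF hF' S => ?_⟩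
  · obtain ⟨g, hg, hgle, S, hS⟩ := exists_idealGrade_add_card (k := k) G
    rw [IsKonigType, hg]
    constructor
    · intro h
      obtain ⟨F, hF⟩ := exists_isMaximalLinearForest G
      rw [hF.LF_eq, Nat.cast_inj] at h
      exact ⟨F, S, (hF.isLFCover_iff S).2 (h ▸ hS)⟩
    · rintro ⟨F, T, hFT⟩
      have hF := hFT.isMaximal
      rw [hF.LF_eq, Nat.cast_inj]
      have h1 := (hF.isLFCover_iff T).1 hFT
      have h2 := hgle T
      have h3 := hF.isLinearForest.ncard_edgeSet_add_card_le hF.le S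
      -- The grade attains its bound at `S` and |E(F)| attains its bound at `T`; comparing each with
      -- the other's bound forces them to agree.
      omega
  · have h := hF.LF_eq.symm.trans hF'.LF_eq
    rw [Nat.cast_inj] at h
    rw [hF.isLFCover_iff, hF'.isLFCover_iff, h]
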